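/- **Setting.** Fix $d\ge 1$ and $D,B,P>0$, $\sigma^2\ge 0$; write $\mathtt{SNR}=P/\sigma^2$, where $\sigma^2=0$ (a noiseless channel) is the case $\mathtt{SNR}=\infty$; $\log$ is to the base $2$. For a nonempty convex set $\mathcal X\subset\mathbb R^d$ of diameter at most $D$, let $\mathcal O$ be the set of pairs $(f,O)$ of a convex function $f:\mathcal X\to\mathbb R$ and an oracle $O$ that answers each query $x\in\mathcal X$ with a fresh random vector $\hat g(x)\in\mathbb R^d$ with $\mathbb E[\hat g(x)]\in\partial f(x)$ and $\mathbb E\|\hat g(x)\|^2\le B^2$. A code of length $\ell\ge1$ is an encoder $\varphi:\mathbb R^d\times\mathcal U\to\mathbb R^\ell$ with public randomness $U\in\mathcal U$. In round $t=1,\dots,T$ an algorithm $\pi$ queries the oracle at a point $x_t\in\mathcal X$, which depends on its randomness (including the public randomness) and on the earlier channel outputs; the oracle output $\hat g_t$ is encoded as $\varphi(\hat g_t,U_t)$, with $\mathbb E\|\varphi(\hat g_t,U_t)\|^2\le\ell P$ and every $U_t$ distributed as $U$; and $\pi$ observes $Y_t=\varphi(\hat g_t,U_t)+Z_t$ with independent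 noise $Z_t\sim\mathcal N(0,\sigma^2 I_\ell)$. After $T$ queries $\pi$ outputs $x_{\rm out}\in\mathcal X$. The code is a *$k$-coordinate sampling code* if the codeword of $x$ consists only of the values of $k$ coordinates of $x$ and their indices, i.e. $\varphi(x)$ represents (given $U$) a pair $(S,\{x(i)\}_{i\in S})$ with $S\subset[d]$, $|S|=k$, where $S$ may depend on $x$ (top-$k$ is an example). Let $$\mathcal E^*_{{\tt k}cs}(N)=\sup_{\mathcal X}\ \inf_{(\pi,\varphi):\ \ell T\le N}\ \sup_{(f,O)\in\mathcal O}\ \Big(\mathbb E f(x_{\rm out})-\inf_{\mathcal X}f\Big),$$ where the infimum is over protocols whose code $\varphi$ is a $k$-coordinate sampling code. **Lemma.** There is a universal constant $c>0$ such that, for all $D,B,P>0$ and $\sigma^2\ge0$ (hence for all values of $\mathtt{SNR}$, including $\mathtt{SNR}=\infty$), the following hold. 1. If $1\le k\le d/2$ and $N\ge d/\min\{d,k\log\frac dk\}$, then $$\mathcal E^*_{{\tt k}cs}(N)\ \ge\ \frac{cDB}{\sqrt N}\sqrt{\frac{d}{\min\{d,\,k\log\frac dk\}}}.$$ 2. If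 $1\le k\le d$ and $N\ge d/\min\{d,k(1+\log\frac dk)\}$, then $$\mathcal E^*_{{\tt k}cs}(N)\ \ge\ \frac{cDB}{\sqrt N}\sqrt{\frac{d}{\min\{d,\,k(1+\log\frac dk)\}}}.$$ In particular such codes do not attain the classic rate $O(DB/\sqrt N)$ even at infinite $\mathtt{SNR}$: for every $C>0$ there is $\varepsilon\in(0,1/2]$ such that, for $\sigma^2=0$, all $D,B,P>0$, all $1\le k\le\varepsilon d$ and all $N\ge d/\min\{d,k\log\frac dk\}$, $\mathcal E^*_{{\tt k}cs}(N)\ge C\,DB/\sqrt N$. -/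

import Mathlib

open MeasureTheory ProbabilityTheory
open scoped ENNReal NNReal

namespace OverTheAir

/-- The Euclidean space `ℝ^d`. -/
abbrev Vec (d : ℕ) : Type := EuclideanSpace ℝ (Fin d)

/-- `g` is a subgradient at `x` of the function `f` on the domain `X`. -/
def IsSubgradientOn {d : ℕ} (X : Set (Vec d)) (f : Vec d → ℝ) (x g : Vec d) : Prop :=
  ∀ y ∈ X, f x + inner ℝ g (y - x) ≤ f y

/-- A pair `(f, O)`: a convex function on `X` (only its values on `X` matter) and a first order
oracle for it. When `x` is queried, the oracle answers with a fresh sample of `oracle x`; for every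
`x ∈ X` its mean is a subgradient of `f` at `x`, and its second moment is at most `B ^ 2`. -/
structure OraclePair {d : ℕ} (X : Set (Vec d)) (B : ℝ) where
  f : Vec d → ℝ
  oracle : Kernel (Vec d) (Vec d)
  markov : IsMarkovKernel oracle
  convex : ConvexOn ℝ X f
  unbiased : ∀ x ∈ X, IsSubgradientOn X f x (∫ g, g ∂(oracle x))
  meanSquare : ∀ x ∈ X, ∫⁻ g, ‖g‖ₑ ^ 2 ∂(oracle x) ≤ ENNReal.ofReal (B ^ 2)

/-- An encoder `φ : ℝ^d × 𝒰 → ℝ^ℓ`, randomized by public randomness with law `law` on `𝒰`. -/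
structure Code (d ℓ : ℕ) where
  𝒰 : Type
  mU : MeasurableSpace 𝒰
  law : Measure 𝒰
  prob : IsProbabilityMeasure law
  enc : Vec d → 𝒰 → (Fin ℓ → ℝ)
  measurable_enc : Measurable (fun q : Vec d × 𝒰 => enc q.1 q.2)

attribute [instance] Code.mU Code.prob OraclePair.markov

/-- The codeword for `x` consists only of the values of `k` coordinates of `x` and their indices:
it is determined (given the public randomness) by a set `S` of `k` coordinates, which may depend
on `x`, together with `{x(i)}_{i ∈ S}`. The map `e` is the representation of such a pair
by a vector of channel inputs. -/
def Code.IsCoordinateSampling {d ℓ : ℕ} (k : ℕ) (φ : Code d ℓ) : Prop :=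
  ∃ (S : Vec d → φ.𝒰 → Finset (Fin d))
    (e : φ.𝒰 → (s : Finset (Fin d)) → (s → ℝ) → (Fin ℓ → ℝ)),
    (∀ x u, (S x u).card = k) ∧
    ∀ x u, φ.enc x u = e u (S x u) (fun i => x i)

/-- An optimization algorithm on `X` making `T` oracle queries (numbered `0, …, T - 1`) through
the code `φ`. The point `ω` carries all randomness of the algorithm, public and private; `U t ω` is
the public randomness that the encoder uses for the `t`-th query. The `t`-th query depends on
`ω` and on the first `t` channel outputs, the final output on `ω` and all `T` channel outputs.
(Entries `U t`, `query t` with `t ≥ T` play no role.) -/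
structure Algorithm {d ℓ : ℕ} (X : Set (Vec d)) (T : ℕ) (φ : Code d ℓ) where
  Ω : Type
  mΩ : MeasurableSpace Ω
  μ : Measure Ω
  prob : IsProbabilityMeasure μ
  U : ℕ → Ω → φ.𝒰
  measurable_U : ∀ t, Measurable (U t)
  law_U : ∀ t, μ.map (U t) = φ.law
  query : (t : ℕ) → Ω × (Fin t → Fin ℓ → ℝ) → Vec d
  measurable_query : ∀ t, Measurable (query t)
  query_mem : ∀ t s, query t s ∈ X
  output : Ω × (Fin T → Fin ℓ → ℝ) → Vec d
  measurable_output : Measurable output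
  output_mem : ∀ s, output s ∈ X

attribute [instance] Algorithm.mΩ Algorithm.prob

/-- The noise of `ℓ` uses of the Gaussian channel: i.i.d. `𝒩(0, σ²)` coordinates.
For `σ² = 0` the channel is noiseless. -/
noncomputable def channelNoise (ℓ : ℕ) (σ2 : ℝ≥0) : Measure (Fin ℓ → ℝ) :=
  Measure.pi (fun _ => gaussianReal 0 σ2)

section

variable {d ℓ T : ℕ} {X : Set (Vec d)} {φ : Code d ℓ}

/-- The joint law of the randomness `ω` and the first `t` channel outputs `Y_0, …, Y_{t-1}`:
in round `t` the oracle draws `ĝ ∼ oracle (query t)`, and the output `φ(ĝ, U_t) + Z`, with fresh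
channel noise `Z`, is appended. -/
noncomputable def Algorithm.transcriptLaw (π : Algorithm X T φ) (σ2 : ℝ≥0)
    (O : Kernel (Vec d) (Vec d)) : (t : ℕ) → Measure (π.Ω × (Fin t → Fin ℓ → ℝ))
  | 0 => π.μ.map (fun ω => (ω, fun i => i.elim0))
  | t + 1 =>
    (((π.transcriptLaw σ2 O t).compProd (O.comap (π.query t) (π.measurable_query t))).prod
        (channelNoise ℓ σ2)).map
      (fun s => (s.1.1.1,
        Fin.snoc (α := fun _ => Fin ℓ → ℝ) s.1.1.2 (φ.enc s.1.2 (π.U t s.1.1.1) + s.2)))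

/-- The average power constraint `E ‖φ(ĝ_t, U_t)‖² ≤ ℓ P`, for each of the `T` transmitted
codewords and whatever the function and the oracle are. -/
def Algorithm.SatisfiesPower (π : Algorithm X T φ) (B P : ℝ) (σ2 : ℝ≥0) : Prop :=
  ∀ (p : OraclePair X B) (t : ℕ), t < T →
    ∫⁻ s, ENNReal.ofReal (∑ i, (φ.enc s.2 (π.U t s.1.1) i) ^ 2)
      ∂((π.transcriptLaw σ2 p.oracle t).compProd
        (p.oracle.comap (π.query t) (π.measurable_query t)))
      ≤ ENNReal.ofReal (ℓ * P)

/-- The convergence error: the expectation of `f (x_T) - min_X f`, which is nonnegative. -/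
noncomputable def Algorithm.error {B : ℝ} (π : Algorithm X T φ) (σ2 : ℝ≥0)
    (p : OraclePair X B) : ℝ≥0∞ :=
  ∫⁻ s, ENNReal.ofReal (p.f (π.output s) - sInf (p.f '' X)) ∂(π.transcriptLaw σ2 p.oracle T)

end

/-- The min-max error with `N` channel uses on domains of diameter at most `D`, when the codes are
restricted to the class `𝒞`. -/
noncomputable def minMaxError (𝒞 : ∀ d ℓ : ℕ, Code d ℓ → Prop) (d N : ℕ) (D B P : ℝ)
    (σ2 : ℝ≥0) : ℝ≥0∞ :=
  ⨆ (X : Set (Vec d)) (_ : X.Nonempty) (_ : Convex ℝ X) (_ : ∀ x ∈ X, ∀ y ∈ X, ‖x - y‖ ≤ D),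
    ⨅ (ℓ : ℕ) (T : ℕ) (_ : 1 ≤ ℓ) (_ : ℓ * T ≤ N) (φ : Code d ℓ) (_ : 𝒞 d ℓ φ)
      (π : Algorithm X T φ) (_ : π.SatisfiesPower B P σ2),
      ⨆ p : OraclePair X B, π.error σ2 p

/-- The min-max error of `k`-coordinate sampling codes. -/
noncomputable def kcsError (k d N : ℕ) (D B P : ℝ) (σ2 : ℝ≥0) : ℝ≥0∞ :=
  minMaxError (fun _ _ φ => φ.IsCoordinateSampling k) d N D B P σ2

end OverTheAir

/-! The domain is a cube, and the functions are `a‖x - r v‖₁` on it, indexed by sign vectors `v`.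
The oracle ignores the query and returns `-B/√d` times random signs, independent and biased towards
`v` by `δ`. A point with many wrong signs has large error, so optimizing amounts to estimating most
bits of `v`, and adaptive queries gain nothing.

On such answers a `k`-coordinate codeword is, given the public randomness, a function of a set of
`k` coordinates and `k` bits. This message takes at most `choose d k * 2 ^ k` values, so its entropy
is `O(k (1 + log (d/k)))`. Channel noise and private randomness are independent of the answers and
can be fixed in advance (`exists_lintegral_transcriptLaw_eq`), so the bound holds at every noise
level.

Flipping one bit of `v` changes the probability of a message by a level-one coefficient of its
preimage. By `level_one_inequality` the squares of these sum over coordinates to `O(p² log (1/p))`.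
Averaged over messages, the total Hellinger change is `O(δ² min(d, entropy))`
(`sum_one_sub_affinity_le`). Assouad's method (`le_sum_bit_errors`) then leaves a constant fraction
of the bits undecided as long as `T δ² min(d, entropy)` is below a small multiple of `d`. The
largest such `δ` gives the rate. -/

namespace OverTheAir

/-! ### Biased product laws on the cube and the level-one inequality. -/

section Finite

open Finset

/-- The sign in `{-1, 1}` of a bit. -/
def bitSign (b : Bool) : ℝ := if b then 1 else -1

theorem bitSign_sq (b : Bool) : bitSign b * bitSign b = 1 := by cases b <;> norm_num [bitSign]

/-- The probability of the bit `a` under the law on bits that is biased towards `b` by `δ`. -/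
noncomputable def bitProb (δ : ℝ) (b a : Bool) : ℝ := (1 + δ * (bitSign b * bitSign a)) / 2

theorem bitProb_pos {δ : ℝ} (h0 : 0 ≤ δ) (h1 : δ < 1) (b a : Bool) : 0 < bitProb δ b a := by
  cases a <;> cases b <;> simp only [bitProb, bitSign] <;> norm_num <;> linarith

theorem sum_bitProb (δ : ℝ) (b : Bool) : ∑ a, bitProb δ b a = 1 := by
  cases b <;> simp only [bitProb, bitSign, Fintype.sum_bool] <;> norm_num <;> ring

theorem sum_bitProb_mul_bitSign (δ : ℝ) (b : Bool) :
    ∑ a, bitProb δ b a * bitSign a = δ * bitSign b := by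
  cases b <;> simp only [bitProb, bitSign, Fintype.sum_bool] <;> norm_num <;> ring

/-- By convexity, the centring factor `exp (-lδ)` is at most the moment generating function of a bit
with the opposite bias. AM-GM bounds the product of the two functions by `cosh² l`, and `cosh l ≤
exp (l²/2)`. -/
theorem sum_bitProb_mul_exp_le {δ : ℝ} (h0 : 0 ≤ δ) (h1 : δ < 1) (b : Bool) (l : ℝ) :
    ∑ a, bitProb δ b a * Real.exp (l * (bitSign b * bitSign a - δ)) ≤ Real.exp (l ^ 2) := by
  have hsum : ∑ a, bitProb δ b a * Real.exp (l * (bitSign b * bitSign a - δ)) =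
      ((1 + δ) / 2 * Real.exp l + (1 - δ) / 2 * Real.exp (-l)) * Real.exp (-(l * δ)) := by
    have e1 : Real.exp (l * (1 - δ)) = Real.exp l * Real.exp (-(l * δ)) := by
      rw [← Real.exp_add]; ring_nf
    have e2 : Real.exp (l * (-1 - δ)) = Real.exp (-l) * Real.exp (-(l * δ)) := by
      rw [← Real.exp_add]; ring_nf
    cases b <;> simp only [bitProb, bitSign, Fintype.sum_bool] <;> norm_num <;>
      rw [e1, e2] <;> ring
  have hconv : Real.exp (-(l * δ)) ≤ (1 - δ) / 2 * Real.exp l + (1 + δ) / 2 * Real.exp (-l) := by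
    have := convexOn_exp.2 (Set.mem_univ l) (Set.mem_univ (-l))
      (show 0 ≤ (1 - δ) / 2 by linarith) (show 0 ≤ (1 + δ) / 2 by linarith) (by ring)
    simp only [smul_eq_mul] at this
    refine le_trans (le_of_eq ?_) this
    congr 1; ring
  have hp := Real.exp_pos l
  have hn := Real.exp_pos (-l)
  have hcosh : (Real.exp l + Real.exp (-l)) / 2 ≤ Real.exp (l ^ 2 / 2) := by
    rw [← Real.cosh_eq]; exact Real.cosh_le_exp_half_sq l
  have hsq : Real.exp (l ^ 2) = Real.exp (l ^ 2 / 2) * Real.exp (l ^ 2 / 2) := by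
    rw [← Real.exp_add]; ring_nf
  rw [hsum, hsq]
  calc _ ≤ ((1 + δ) / 2 * Real.exp l + (1 - δ) / 2 * Real.exp (-l)) *
        ((1 - δ) / 2 * Real.exp l + (1 + δ) / 2 * Real.exp (-l)) := by
        have : 0 ≤ 1 - δ := by linarith
        gcongr
    _ ≤ ((Real.exp l + Real.exp (-l)) / 2) * ((Real.exp l + Real.exp (-l)) / 2) := by
        nlinarith [sq_nonneg (δ * (Real.exp l - Real.exp (-l)))]
    _ ≤ _ := by gcongr

variable {d : ℕ}

/-- The product law on `{0, 1}^d` that is biased towards `v` by `δ` in every coordinate. -/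
noncomputable def cubeProb (δ : ℝ) (v x : Fin d → Bool) : ℝ := ∏ i, bitProb δ (v i) (x i)

theorem cubeProb_pos {δ : ℝ} (h0 : 0 ≤ δ) (h1 : δ < 1) (v x : Fin d → Bool) :
    0 < cubeProb δ v x := prod_pos fun _ _ => bitProb_pos h0 h1 _ _

theorem sum_cubeProb (δ : ℝ) (v : Fin d → Bool) : ∑ x, cubeProb δ v x = 1 := by
  simp only [cubeProb, ← Fintype.prod_sum fun i a => bitProb δ (v i) a, sum_bitProb, prod_const_one]

theorem sum_cubeProb_mul_bitSign (δ : ℝ) (v : Fin d → Bool) (i : Fin d) :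
    ∑ x, cubeProb δ v x * bitSign (x i) = δ * bitSign (v i) := by
  have h : ∀ x : Fin d → Bool, cubeProb δ v x * bitSign (x i) =
      ∏ j, bitProb δ (v j) (x j) * (if j = i then bitSign (x j) else 1) := fun x => by
    rw [prod_mul_distrib, prod_ite_eq' univ i]; simp [cubeProb]
  simp only [h]
  rw [← Fintype.prod_sum fun j a => bitProb δ (v j) a * (if j = i then bitSign a else 1),
    prod_eq_single i]
  · simpa only [if_pos] using sum_bitProb_mul_bitSign δ (v i)
  · intro j _ hj; simpa only [if_neg hj, mul_one] using sum_bitProb δ (v j)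
  · simp

theorem sum_cubeProb_mul_exp_le {δ : ℝ} (h0 : 0 ≤ δ) (h1 : δ < 1) (v : Fin d → Bool)
    (l : Fin d → ℝ) :
    ∑ x, cubeProb δ v x * Real.exp (∑ i, l i * (bitSign (v i) * bitSign (x i) - δ)) ≤
      Real.exp (∑ i, l i ^ 2) := by
  simp only [cubeProb, Real.exp_sum, ← prod_mul_distrib]
  rw [← Fintype.prod_sum fun i a =>
    bitProb δ (v i) a * Real.exp (l i * (bitSign (v i) * bitSign a - δ))]
  refine prod_le_prod (fun i _ => sum_nonneg fun a _ => ?_)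
    fun i _ => sum_bitProb_mul_exp_le h0 h1 _ _
  have := (bitProb_pos h0 h1 (v i) a).le
  positivity

/-- The vertex `v` with the `i`-th coordinate flipped. -/
def flip (i : Fin d) (v : Fin d → Bool) : Fin d → Bool := Function.update v i (!v i)

theorem flip_flip (i : Fin d) (v : Fin d → Bool) : flip i (flip i v) = v := by
  simp [flip]

theorem flip_apply_self (i : Fin d) (v : Fin d → Bool) : flip i v i = !v i := by simp [flip]

/-- The likelihood ratio of two biased bits is affine in the bit, so a flip perturbs the law by an
exact multiple of the centred bit, with no higher-order terms. -/
theorem cubeProb_flip {δ : ℝ} (h0 : 0 ≤ δ) (h1 : δ < 1) (i : Fin d) (v x : Fin d → Bool) :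
    cubeProb δ (flip i v) x =
      cubeProb δ v x - 2 * δ / (1 - δ ^ 2) *
        (cubeProb δ v x * (bitSign (v i) * bitSign (x i) - δ)) := by
  have hb : bitProb δ (!v i) (x i) = bitProb δ (v i) (x i) *
      (1 - 2 * δ / (1 - δ ^ 2) * (bitSign (v i) * bitSign (x i) - δ)) := by
    have : 1 - δ ^ 2 ≠ 0 := by nlinarith
    cases v i <;> cases x i <;> simp only [bitProb, bitSign] <;> norm_num <;> field_simp <;> ring
  have e1 : cubeProb δ (flip i v) x = bitProb δ (!v i) (x i) *
      ∏ j ∈ univ.erase i, bitProb δ (v j) (x j) := by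
    rw [cubeProb, ← mul_prod_erase univ _ (mem_univ i), flip_apply_self]
    congr 1
    refine prod_congr rfl fun j hj => ?_
    rw [flip, Function.update_of_ne (ne_of_mem_erase hj)]
  have e2 : cubeProb δ v x = bitProb δ (v i) (x i) *
      ∏ j ∈ univ.erase i, bitProb δ (v j) (x j) := by
    rw [cubeProb, ← mul_prod_erase univ _ (mem_univ i)]
  rw [e1, e2, hb]; ring

/-- The level-one inequality for a subset of the cube with a biased product law. -/
theorem level_one_inequality {δ : ℝ} (h0 : 0 ≤ δ) (h1 : δ < 1) (v : Fin d → Bool)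
    (A : Finset (Fin d → Bool)) (hA : 0 < ∑ x ∈ A, cubeProb δ v x) :
    ∑ i, (∑ x ∈ A, cubeProb δ v x * (bitSign (v i) * bitSign (x i) - δ)) ^ 2 ≤
      4 * (∑ x ∈ A, cubeProb δ v x) ^ 2 * -Real.log (∑ x ∈ A, cubeProb δ v x) := by
  set p := ∑ x ∈ A, cubeProb δ v x with hp
  set b : Fin d → ℝ := fun i => ∑ x ∈ A, cubeProb δ v x * (bitSign (v i) * bitSign (x i) - δ)
    with hb
  -- This choice maximizes `⟨l, b/p⟩ - ‖l‖²`, where `b/p` is the mean of the centred bits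
  -- conditioned on `A`. The number `c` is the conditional mean of the exponent; the tangent to
  -- `exp` at `c` gives Jensen's inequality on `A`.
  set l : Fin d → ℝ := fun i => b i / (2 * p) with hl
  set c : ℝ := (∑ i, l i * b i) / p with hc
  have key : p * Real.exp c ≤ Real.exp (∑ i, l i ^ 2) := by
    refine le_trans ?_ (sum_cubeProb_mul_exp_le h0 h1 v l)
    refine le_trans ?_ (sum_le_univ_sum_of_nonneg (s := A) fun x =>
      mul_nonneg (cubeProb_pos h0 h1 v x).le (Real.exp_pos _).le)
    have tangent : ∀ x ∈ A, cubeProb δ v x * (Real.exp c *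
        (1 + ((∑ i, l i * (bitSign (v i) * bitSign (x i) - δ)) - c))) ≤
        cubeProb δ v x * Real.exp (∑ i, l i * (bitSign (v i) * bitSign (x i) - δ)) := by
      intro x _
      refine mul_le_mul_of_nonneg_left ?_ (cubeProb_pos h0 h1 v x).le
      have := Real.add_one_le_exp ((∑ i, l i * (bitSign (v i) * bitSign (x i) - δ)) - c)
      calc _ ≤ Real.exp c * Real.exp ((∑ i, l i * (bitSign (v i) * bitSign (x i) - δ)) - c) := by
            gcongr; linarith
        _ = _ := by rw [← Real.exp_add, add_sub_cancel]
    refine le_trans (le_of_eq ?_) (sum_le_sum tangent)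
    have hlin : ∑ x ∈ A, cubeProb δ v x * ∑ i, l i * (bitSign (v i) * bitSign (x i) - δ) =
        c * p := by
      rw [hc, div_mul_cancel₀ _ hA.ne']
      simp only [hb, mul_sum]
      rw [sum_comm]
      exact sum_congr rfl fun i _ => sum_congr rfl fun x _ => by ring
    have : ∀ x, cubeProb δ v x * (Real.exp c *
        (1 + ((∑ i, l i * (bitSign (v i) * bitSign (x i) - δ)) - c))) =
        Real.exp c * ((1 - c) * cubeProb δ v x +
          cubeProb δ v x * ∑ i, l i * (bitSign (v i) * bitSign (x i) - δ)) := fun x => by ring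
    simp only [this, ← mul_sum, sum_add_distrib, hlin]
    rw [← hp]; ring
  have hlog := Real.log_le_log (by positivity) key
  rw [Real.log_mul hA.ne' (Real.exp_pos _).ne', Real.log_exp, Real.log_exp] at hlog
  have hc' : c = (∑ i, b i ^ 2) / (2 * p ^ 2) := by
    rw [hc, hl, div_eq_div_iff hA.ne' (by positivity), sum_mul, sum_mul]
    exact sum_congr rfl fun i _ => by field_simp
  have hl' : ∑ i, l i ^ 2 = (∑ i, b i ^ 2) / (4 * p ^ 2) := by
    rw [sum_div]
    exact sum_congr rfl fun i _ => by simp only [hl]; field_simp; ring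
  rw [hc', hl'] at hlog
  have h4 : (∑ i, b i ^ 2) / (4 * p ^ 2) ≤ -Real.log p := by
    have : (∑ i, b i ^ 2) / (2 * p ^ 2) = 2 * ((∑ i, b i ^ 2) / (4 * p ^ 2)) := by
      field_simp; ring
    linarith
  rw [div_le_iff₀ (by positivity)] at h4
  linarith

/-- Each centred bit is at most 2 in absolute value. This crude bound supplies the alternative `d`
in the minimum. -/
theorem sum_sq_sum_cubeProb_le {δ : ℝ} (h0 : 0 ≤ δ) (h1 : δ < 1) (v : Fin d → Bool)
    (A : Finset (Fin d → Bool)) :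
    ∑ i, (∑ x ∈ A, cubeProb δ v x * (bitSign (v i) * bitSign (x i) - δ)) ^ 2 ≤
      4 * (∑ x ∈ A, cubeProb δ v x) ^ 2 * d := by
  have hi : ∀ i : Fin d, (∑ x ∈ A, cubeProb δ v x * (bitSign (v i) * bitSign (x i) - δ)) ^ 2 ≤
      4 * (∑ x ∈ A, cubeProb δ v x) ^ 2 := fun i => by
    have habs : |∑ x ∈ A, cubeProb δ v x * (bitSign (v i) * bitSign (x i) - δ)| ≤
        2 * ∑ x ∈ A, cubeProb δ v x := by
      refine (abs_sum_le_sum_abs _ _).trans ?_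
      rw [mul_sum]
      refine sum_le_sum fun x _ => ?_
      rw [abs_mul, abs_of_pos (cubeProb_pos h0 h1 v x), mul_comm]
      refine mul_le_mul_of_nonneg_right ?_ (cubeProb_pos h0 h1 v x).le
      cases v i <;> cases x i <;> simp only [bitSign] <;> norm_num <;> rw [abs_le] <;>
        constructor <;> linarith
    calc _ = |∑ x ∈ A, cubeProb δ v x * (bitSign (v i) * bitSign (x i) - δ)| ^ 2 := (sq_abs _).symm
      _ ≤ (2 * ∑ x ∈ A, cubeProb δ v x) ^ 2 := by gcongr
      _ = _ := by ring
  calc _ ≤ ∑ _i : Fin d, 4 * (∑ x ∈ A, cubeProb δ v x) ^ 2 := sum_le_sum fun i _ => hi i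
    _ = _ := by simp; ring

/-- The entropy of a law on a finite type is at most the logarithm of the cardinality. -/
theorem sum_mul_neg_log_le {α : Type*} [Fintype α] (p : α → ℝ) (hp : ∀ a, 0 ≤ p a)
    (hsum : ∑ a, p a = 1) : ∑ a, p a * -Real.log (p a) ≤ Real.log (Fintype.card α) := by
  have hne : Nonempty α := by
    by_contra h
    rw [not_nonempty_iff] at h
    simp at hsum
  have hM : (0 : ℝ) < Fintype.card α := by exact_mod_cast Fintype.card_pos
  have h : ∀ a, p a * -Real.log (p a) ≤
      p a * Real.log (Fintype.card α) + (1 / Fintype.card α - p a) := by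
    intro a
    rcases (hp a).eq_or_lt with h | h
    · rw [← h]; simp
    · have := Real.log_le_sub_one_of_pos (show 0 < 1 / (p a * Fintype.card α) by positivity)
      rw [one_div, Real.log_inv, Real.log_mul h.ne' hM.ne'] at this
      have h2 := mul_le_mul_of_nonneg_left this h.le
      have h3 : p a * ((p a * Fintype.card α)⁻¹ - 1) = 1 / Fintype.card α - p a := by field_simp
      linarith
  refine (sum_le_sum fun a _ => h a).trans ?_
  rw [sum_add_distrib, ← sum_mul, sum_sub_distrib, hsum]
  simp [hM.ne']

end Finite

/-! ### Hellinger affinity, information carried by one message, and Assouad's method. -/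

section Finite

open Finset

/-- The Bhattacharyya affinity of two laws on a finite type. -/
noncomputable def affinity {α : Type*} [Fintype α] (p q : α → ℝ) : ℝ := ∑ a, √(p a) * √(q a)

theorem affinity_nonneg {α : Type*} [Fintype α] (p q : α → ℝ) : 0 ≤ affinity p q :=
  sum_nonneg fun _ _ => by positivity

theorem one_sub_affinity {α : Type*} [Fintype α] {p q : α → ℝ} (hp : ∀ a, 0 ≤ p a)
    (hq : ∀ a, 0 ≤ q a) (hp1 : ∑ a, p a = 1) (hq1 : ∑ a, q a = 1) :
    1 - affinity p q = (∑ a, (√(p a) - √(q a)) ^ 2) / 2 := by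
  have : ∀ a, (√(p a) - √(q a)) ^ 2 = p a + q a - 2 * (√(p a) * √(q a)) := fun a => by
    linear_combination Real.sq_sqrt (hp a) + Real.sq_sqrt (hq a)
  simp only [this, sum_sub_distrib, sum_add_distrib, hp1, hq1, ← mul_sum, affinity]
  ring

theorem affinity_le_one {α : Type*} [Fintype α] {p q : α → ℝ} (hp : ∀ a, 0 ≤ p a)
    (hq : ∀ a, 0 ≤ q a) (hp1 : ∑ a, p a = 1) (hq1 : ∑ a, q a = 1) : affinity p q ≤ 1 := by
  have := one_sub_affinity hp hq hp1 hq1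
  have h2 : 0 ≤ (∑ a, (√(p a) - √(q a)) ^ 2) / 2 := by positivity
  linarith

/-- Le Cam's inequality: the sum of the error probabilities of a test is bounded below by the
affinity of the two laws. -/
theorem sq_affinity_le_sum_min {α : Type*} [Fintype α] {p q : α → ℝ} (hp : ∀ a, 0 ≤ p a)
    (hq : ∀ a, 0 ≤ q a) (hp1 : ∑ a, p a = 1) (hq1 : ∑ a, q a = 1) :
    affinity p q ^ 2 / 2 ≤ ∑ a, min (p a) (q a) := by
  have hmm : ∀ a, √(p a) * √(q a) = √(min (p a) (q a)) * √(max (p a) (q a)) := fun a => by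
    rcases le_total (p a) (q a) with h | h
    · rw [min_eq_left h, max_eq_right h]
    · rw [min_eq_right h, max_eq_left h, mul_comm]
  have hcs : affinity p q ^ 2 ≤ (∑ a, min (p a) (q a)) * ∑ a, max (p a) (q a) := by
    have := sum_mul_sq_le_sq_mul_sq univ (fun a => √(min (p a) (q a)))
      fun a => √(max (p a) (q a))
    simp only [← hmm, Real.sq_sqrt (le_min (hp _) (hq _)),
      Real.sq_sqrt (le_max_of_le_left (hp _))] at this
    exact this
  have hmax : ∑ a, max (p a) (q a) ≤ 2 := by
    calc _ ≤ ∑ a, (p a + q a) := sum_le_sum fun a _ => max_le_add_of_nonneg (hp a) (hq a)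
      _ = 2 := by rw [sum_add_distrib, hp1, hq1]; norm_num
  have hmin : 0 ≤ ∑ a, min (p a) (q a) := sum_nonneg fun a _ => le_min (hp a) (hq a)
  nlinarith

/-- Affinity tensorizes, which is what makes the losses of the `T` rounds add up. -/
theorem affinity_prod {α : Type*} [Fintype α] {T : ℕ} {p q : Fin T → α → ℝ}
    (hp : ∀ t a, 0 ≤ p t a) (hq : ∀ t a, 0 ≤ q t a) :
    affinity (fun y : Fin T → α => ∏ t, p t (y t)) (fun y => ∏ t, q t (y t)) =
      ∏ t, affinity (p t) (q t) := by
  simp only [affinity]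
  rw [Fintype.prod_sum]
  refine sum_congr rfl fun y _ => ?_
  rw [Real.sqrt_prod _ fun t _ => hp t _, Real.sqrt_prod _ fun t _ => hq t _, prod_mul_distrib]

theorem one_sub_sum_one_sub_le_prod {ι : Type*} (s : Finset ι) (b : ι → ℝ)
    (h0 : ∀ i, 0 ≤ b i) (h1 : ∀ i, b i ≤ 1) : 1 - ∑ i ∈ s, (1 - b i) ≤ ∏ i ∈ s, b i := by
  classical
  induction s using Finset.induction_on with
  | empty => simp
  | insert i s hi ih =>
    rw [sum_insert hi, prod_insert hi]
    have h2 : 0 ≤ ∑ i ∈ s, (1 - b i) := sum_nonneg fun i _ => sub_nonneg.2 (h1 i)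
    nlinarith [mul_le_mul_of_nonneg_left ih (h0 i), mul_nonneg (sub_nonneg.2 (h1 i)) h2]

variable {d : ℕ} {α : Type*} [DecidableEq α]

/-- The law of the message `m x`, where `x` is drawn from the law `cubeProb δ v`. -/
noncomputable def msgProb (δ : ℝ) (m : (Fin d → Bool) → α) (v : Fin d → Bool) (a : α) : ℝ :=
  ∑ x with m x = a, cubeProb δ v x

theorem msgProb_nonneg {δ : ℝ} (h0 : 0 ≤ δ) (h1 : δ < 1) (m : (Fin d → Bool) → α)
    (v : Fin d → Bool) (a : α) : 0 ≤ msgProb δ m v a :=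
  sum_nonneg fun x _ => (cubeProb_pos h0 h1 v x).le

variable [Fintype α]

theorem sum_msgProb (δ : ℝ) (m : (Fin d → Bool) → α) (v : Fin d → Bool) :
    ∑ a, msgProb δ m v a = 1 := by
  simp only [msgProb]
  rw [sum_fiberwise, sum_cubeProb]

/-- The law of a sequence of messages about independent draws is the product law. -/
theorem sum_prod_cubeProb_mul {T : ℕ} (δ : ℝ) (m : Fin T → (Fin d → Bool) → α)
    (v : Fin d → Bool) (F : (Fin T → α) → ℝ) :
    ∑ g : Fin T → Fin d → Bool, (∏ t, cubeProb δ v (g t)) * F (fun t => m t (g t)) =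
      ∑ y, (∏ t, msgProb δ (m t) v (y t)) * F y := by
  rw [← sum_fiberwise univ fun (g : Fin T → Fin d → Bool) t => m t (g t)]
  refine sum_congr rfl fun y _ => ?_
  have hset : ({g | (fun t => m t (g t)) = y} : Finset (Fin T → Fin d → Bool)) =
      Fintype.piFinset fun t => ({x | m t x = y t} : Finset _) := by
    ext g; simp [funext_iff]
  simp only [msgProb]
  rw [prod_univ_sum, ← hset, sum_mul]
  refine sum_congr rfl fun g hg => ?_
  rw [(mem_filter.1 hg).2]

/-- Flipping one coordinate of `v`, on average over the coordinates, changes the law of a message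
only by as much as the message can be informative. -/
theorem sum_one_sub_affinity_le {δ : ℝ} (h0 : 0 ≤ δ) (h1 : δ ≤ 1 / 2)
    (m : (Fin d → Bool) → α) (v : Fin d → Bool) :
    ∑ i, (1 - affinity (msgProb δ m v) (msgProb δ m (flip i v))) ≤
      16 * δ ^ 2 * min (d : ℝ) (Real.log (Fintype.card α)) := by
  have h1' : δ < 1 := by linarith
  set κ := 2 * δ / (1 - δ ^ 2) with hκ
  have hκ2 : κ ^ 2 ≤ 8 * δ ^ 2 := by
    have h3 : 3 / 4 ≤ 1 - δ ^ 2 := by nlinarith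
    rw [hκ, div_pow, div_le_iff₀ (by positivity)]
    nlinarith [sq_nonneg δ, mul_le_mul h3 h3 (by norm_num) (by linarith)]
  set p := msgProb δ m v with hp
  have hp0 : ∀ a, 0 ≤ p a := msgProb_nonneg h0 h1' m v
  set b : Fin d → α → ℝ := fun i a =>
    ∑ x with m x = a, cubeProb δ v x * (bitSign (v i) * bitSign (x i) - δ) with hb
  have hflip : ∀ i a, msgProb δ m (flip i v) a = p a - κ * b i a := fun i a => by
    simp only [hp, hb, msgProb, cubeProb_flip h0 h1', sum_sub_distrib, mul_sum, hκ]
  have hsq : ∀ i a, 0 < p a →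
      (√(p a) - √(msgProb δ m (flip i v) a)) ^ 2 ≤ κ ^ 2 * b i a ^ 2 / p a := fun i a ha => by
    have hq0 := msgProb_nonneg h0 h1' m (flip i v) a
    set q := msgProb δ m (flip i v) a with hq
    have hprod : (√(p a) - √q) * (√(p a) + √q) = κ * b i a := by
      have : κ * b i a = p a - q := by rw [hq, hflip]; ring
      rw [this]; linear_combination Real.sq_sqrt ha.le - Real.sq_sqrt hq0
    rw [le_div_iff₀ ha, ← mul_pow, ← hprod, mul_pow]
    refine mul_le_mul_of_nonneg_left ?_ (sq_nonneg _)
    calc p a = √(p a) ^ 2 := (Real.sq_sqrt ha.le).symm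
      _ ≤ _ := by gcongr; linarith [Real.sqrt_nonneg q]
  have hzero : ∀ i a, p a = 0 → (√(p a) - √(msgProb δ m (flip i v) a)) ^ 2 = 0 := fun i a ha => by
    have hbi : b i a = 0 := sum_eq_zero fun x hx => by
      rw [(sum_eq_zero_iff_of_nonneg fun x _ => (cubeProb_pos h0 h1' v x).le).1 ha x hx, zero_mul]
    rw [hflip, ha, hbi]; simp
  -- Applied with `c = d` (crude bound) and with `c = -log (p a)` (level-one inequality). In the
  -- second case the sum over `a` is the entropy of the message.
  have hsum : ∀ (c : ℝ) (a : α), (0 < p a → ∑ i, b i a ^ 2 ≤ 4 * p a ^ 2 * c) →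
      ∑ i, (√(p a) - √(msgProb δ m (flip i v) a)) ^ 2 ≤ 32 * δ ^ 2 * (p a * c) := by
    intro c a hc
    rcases (hp0 a).eq_or_lt with h | h
    · exact (sum_eq_zero fun i _ => hzero i a h.symm).le.trans (by simp [← h])
    · calc _ ≤ ∑ i, κ ^ 2 * b i a ^ 2 / p a := sum_le_sum fun i _ => hsq i a h
        _ = κ ^ 2 * ((∑ i, b i a ^ 2) / p a) := by
          rw [sum_div, mul_sum]; exact sum_congr rfl fun i _ => by ring
        _ ≤ 8 * δ ^ 2 * ((∑ i, b i a ^ 2) / p a) := by gcongr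
        _ ≤ 8 * δ ^ 2 * (4 * p a ^ 2 * c / p a) := by gcongr; exact hc h
        _ = _ := by field_simp; ring
  have htotal : ∑ i, (1 - affinity p (msgProb δ m (flip i v))) =
      (∑ a, ∑ i, (√(p a) - √(msgProb δ m (flip i v) a)) ^ 2) / 2 := by
    rw [sum_comm, sum_div]
    exact sum_congr rfl fun i _ => one_sub_affinity hp0 (msgProb_nonneg h0 h1' m _)
      (sum_msgProb δ m v) (sum_msgProb δ m _)
  rw [htotal, mul_min_of_nonneg _ _ (by positivity), le_min_iff]
  constructor
  · have := sum_le_sum fun a (_ : a ∈ univ) => hsum d a fun _ => sum_sq_sum_cubeProb_le h0 h1' v _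
    rw [← mul_sum, ← sum_mul, hp, sum_msgProb] at this
    linarith
  · have := sum_le_sum fun a (_ : a ∈ univ) => hsum (-Real.log (p a)) a
      fun ha => level_one_inequality h0 h1' v _ ha
    rw [← mul_sum] at this
    have hent := mul_le_mul_of_nonneg_left (sum_mul_neg_log_le p hp0 (sum_msgProb δ m v))
      (show 0 ≤ 32 * δ ^ 2 by positivity)
    linarith

/-- Le Cam's inequality for product laws: a lower bound on the sum of the two error probabilities
of a test. -/
theorem one_sub_sum_affinity_le_test_errors {β : Type*} [Fintype β] {T : ℕ}
    {p q : Fin T → β → ℝ} (hp : ∀ t a, 0 ≤ p t a) (hq : ∀ t a, 0 ≤ q t a)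
    (hp1 : ∀ t, ∑ a, p t a = 1) (hq1 : ∀ t, ∑ a, q t a = 1) (est : (Fin T → β) → Bool)
    (b : Bool) :
    1 / 2 - ∑ t, (1 - affinity (p t) (q t)) ≤
      ∑ y, (∏ t, p t (y t)) * (if est y ≠ b then 1 else 0) +
      ∑ y, (∏ t, q t (y t)) * (if est y ≠ !b then 1 else 0) := by
  classical
  have hP : ∀ y : Fin T → β, 0 ≤ ∏ t, p t (y t) := fun y => prod_nonneg fun t _ => hp t _
  have hQ : ∀ y : Fin T → β, 0 ≤ ∏ t, q t (y t) := fun y => prod_nonneg fun t _ => hq t _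
  have hle := sq_affinity_le_sum_min hP hQ
    (by rw [← Fintype.prod_sum fun t a => p t a]; simp [hp1])
    (by rw [← Fintype.prod_sum fun t a => q t a]; simp [hq1])
  rw [affinity_prod hp hq] at hle
  have hprod := one_sub_sum_one_sub_le_prod univ (fun t => affinity (p t) (q t))
    (fun t => affinity_nonneg _ _)
    fun t => affinity_le_one (hp t) (hq t) (hp1 t) (hq1 t)
  -- From `x²/2 ≥ x - 1/2`, with `x` the affinity of the product laws.
  have hsq : 1 / 2 - ∑ t, (1 - affinity (p t) (q t)) ≤ (∏ t, affinity (p t) (q t)) ^ 2 / 2 := by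
    nlinarith [sq_nonneg (∏ t, affinity (p t) (q t) - 1)]
  refine hsq.trans (hle.trans ?_)
  rw [← sum_add_distrib]
  refine sum_le_sum fun y _ => ?_
  by_cases h : est y = b
  · rw [if_neg (by simp [h]), if_pos (by simp [h])]; simp
  · rw [if_pos h, if_neg (by simpa using h)]; simp

/-- Assouad's lemma for `T` messages about independent draws from an unknown biased law on the
cube: if the messages carry little information, no estimator finds most bits of the parameter. -/
theorem le_sum_bit_errors {T : ℕ} {δ : ℝ} (h0 : 0 ≤ δ) (h1 : δ ≤ 1 / 2)
    (hT : T * (16 * δ ^ 2 * min (d : ℝ) (Real.log (Fintype.card α))) ≤ d / 4)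
    (m : Fin T → (Fin d → Bool) → α) (est : (Fin T → α) → Fin d → Bool) :
    2 ^ d * ((d : ℝ) / 8) ≤ ∑ v : Fin d → Bool, ∑ g : Fin T → Fin d → Bool,
      (∏ t, cubeProb δ v (g t)) *
        ∑ i, (if est (fun t => m t (g t)) i ≠ v i then 1 else 0) := by
  have h1' : δ < 1 := by linarith
  set E : (Fin d → Bool) → Fin d → ℝ := fun v i =>
    ∑ y, (∏ t, msgProb δ (m t) v (y t)) * (if est y i ≠ v i then 1 else 0) with hE
  have hrhs : ∀ v : Fin d → Bool, ∑ g : Fin T → Fin d → Bool, (∏ t, cubeProb δ v (g t)) *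
      ∑ i, (if est (fun t => m t (g t)) i ≠ v i then (1 : ℝ) else 0) = ∑ i, E v i := fun v => by
    rw [sum_prod_cubeProb_mul δ m v fun y => ∑ i, (if est y i ≠ v i then (1 : ℝ) else 0), hE]
    simp only [mul_sum]
    rw [sum_comm]
  -- Flipping is an involution of the cube, so after summing over `v` each two-point bound counts
  -- every error probability twice.
  have hflip : ∀ i, ∑ v, E (flip i v) i = ∑ v, E v i := fun i =>
    Equiv.sum_comp (Function.Involutive.toPerm (flip i) (flip_flip i)) fun v => E v i
  have hbound : ∀ v, (d : ℝ) / 4 ≤ ∑ i, (E v i + E (flip i v) i) := fun v => by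
    have htest : ∀ i, 1 / 2 - ∑ t, (1 - affinity (msgProb δ (m t) v)
        (msgProb δ (m t) (flip i v))) ≤ E v i + E (flip i v) i := fun i => by
      have := one_sub_sum_affinity_le_test_errors (fun t => msgProb_nonneg h0 h1' (m t) v)
        (fun t => msgProb_nonneg h0 h1' (m t) (flip i v)) (fun t => sum_msgProb δ (m t) v)
        (fun t => sum_msgProb δ (m t) (flip i v)) (fun y => est y i) (v i)
      simpa only [hE, flip_apply_self] using this
    refine le_trans ?_ (sum_le_sum fun i _ => htest i)
    rw [sum_sub_distrib, sum_comm]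
    have := sum_le_sum fun t (_ : t ∈ univ) => sum_one_sub_affinity_le h0 h1 (m t) v
    simp only [sum_const, card_univ, Fintype.card_fin, nsmul_eq_mul] at this ⊢
    linarith
  have htot := sum_le_sum fun v (_ : v ∈ univ) => hbound v
  simp only [sum_add_distrib] at htot
  rw [sum_comm (f := fun v i => E (flip i v) i), sum_congr rfl fun i (_ : i ∈ univ) => hflip i,
    sum_comm (f := fun i v => E v i)] at htot
  simp only [sum_const, card_univ, Fintype.card_pi, Fintype.card_bool, prod_const,
    Fintype.card_fin, nsmul_eq_mul, Nat.cast_pow, Nat.cast_ofNat] at htot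
  rw [sum_congr rfl fun v _ => hrhs v]
  linarith

end Finite

/-! ### Separating the transcript's randomness from the oracle's answers. -/

section Transcript

variable {d ℓ T : ℕ} {X : Set (Vec d)} {φ : Code d ℓ}

instance (ℓ : ℕ) (σ2 : ℝ≥0) : IsProbabilityMeasure (channelNoise ℓ σ2) := by
  unfold channelNoise; infer_instance

instance (π : Algorithm X T φ) (σ2 : ℝ≥0) (O : Kernel (Vec d) (Vec d)) (t : ℕ) :
    SFinite (π.transcriptLaw σ2 O t) := by
  cases t <;> unfold Algorithm.transcriptLaw <;> infer_instance

theorem measurable_snoc {β γ : Type*} [MeasurableSpace β] [MeasurableSpace γ] {t : ℕ}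
    {f : β → Fin t → γ} {g : β → γ} (hf : Measurable f) (hg : Measurable g) :
    Measurable fun b => (Fin.snoc (α := fun _ => γ) (f b) (g b) : Fin (t + 1) → γ) := by
  refine measurable_pi_iff.2 fun i => ?_
  induction i using Fin.lastCases with
  | last => simpa using hg
  | cast i => simpa using measurable_pi_iff.1 hf i

theorem measurable_enc_add (π : Algorithm X T φ) (t : ℕ) {β : Type*} [MeasurableSpace β]
    {x : β → Vec d} {ω : β → π.Ω} {z : β → Fin ℓ → ℝ} (hx : Measurable x) (hω : Measurable ω)
    (hz : Measurable z) : Measurable fun b => φ.enc (x b) (π.U t (ω b)) + z b :=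
  (φ.measurable_enc.comp (hx.prodMk ((π.measurable_U t).comp hω))).add hz

variable {ι : Type*} [Fintype ι] {emb : ι → Vec d}

theorem lintegral_transcriptLaw_succ (π : Algorithm X T φ) (σ2 : ℝ≥0) (O : Kernel (Vec d) (Vec d))
    [IsMarkovKernel O] (w : ι → ℝ≥0∞)
    (hO : ∀ x (F : Vec d → ℝ≥0∞), Measurable F → ∫⁻ g, F g ∂(O x) = ∑ a, w a * F (emb a))
    (t : ℕ) (F : π.Ω × (Fin (t + 1) → Fin ℓ → ℝ) → ℝ≥0∞) (hF : Measurable F) :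
    ∫⁻ s, F s ∂(π.transcriptLaw σ2 O (t + 1)) =
      ∫⁻ s, ∑ a, w a * ∫⁻ z, F (s.1, Fin.snoc (α := fun _ => Fin ℓ → ℝ) s.2
        (φ.enc (emb a) (π.U t s.1) + z)) ∂(channelNoise ℓ σ2) ∂(π.transcriptLaw σ2 O t) := by
  have hm : Measurable fun s : ((π.Ω × (Fin t → Fin ℓ → ℝ)) × Vec d) × (Fin ℓ → ℝ) =>
      (s.1.1.1, (Fin.snoc (α := fun _ => Fin ℓ → ℝ) s.1.1.2
        (φ.enc s.1.2 (π.U t s.1.1.1) + s.2) : Fin (t + 1) → Fin ℓ → ℝ)) :=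
    (by fun_prop : Measurable _).prodMk
      (measurable_snoc (by fun_prop) (measurable_enc_add π t (by fun_prop) (by fun_prop)
        (by fun_prop)))
  have hG : Measurable fun s : (π.Ω × (Fin t → Fin ℓ → ℝ)) × Vec d =>
      ∫⁻ z, F (s.1.1, Fin.snoc (α := fun _ => Fin ℓ → ℝ) s.1.2
        (φ.enc s.2 (π.U t s.1.1) + z)) ∂(channelNoise ℓ σ2) :=
    (hF.comp hm).lintegral_prod_right'
  rw [Algorithm.transcriptLaw, lintegral_map hF hm, lintegral_prod _ (by exact (hF.comp hm).aemeasurable),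
    Measure.lintegral_compProd hG]
  refine lintegral_congr fun s => ?_
  rw [Kernel.comap_apply]
  exact hO _ _ (hG.comp measurable_prodMk_left)

/-- If the oracle answers every query with the same finitely supported law, then the transcript
is a function of randomness that does not depend on this law and of independent draws from it. -/
theorem exists_lintegral_transcriptLaw_eq (π : Algorithm X T φ) (σ2 : ℝ≥0) (emb : ι → Vec d)
    (t : ℕ) :
    ∃ (Θ : Type) (_ : MeasurableSpace Θ) (ρ : Measure Θ) (_ : IsProbabilityMeasure ρ)
      (ω : Θ → π.Ω) (z : Fin t → Θ → Fin ℓ → ℝ), Measurable ω ∧ (∀ j, Measurable (z j)) ∧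
      ∀ (O : Kernel (Vec d) (Vec d)) [IsMarkovKernel O] (w : ι → ℝ≥0∞),
        (∀ x (F : Vec d → ℝ≥0∞), Measurable F → ∫⁻ g, F g ∂(O x) = ∑ a, w a * F (emb a)) →
        ∀ F : π.Ω × (Fin t → Fin ℓ → ℝ) → ℝ≥0∞, Measurable F →
          ∫⁻ s, F s ∂(π.transcriptLaw σ2 O t) =
            ∫⁻ θ, ∑ g : Fin t → ι, (∏ j, w (g j)) *
              F (ω θ, fun j => φ.enc (emb (g j)) (π.U j (ω θ)) + z j θ) ∂ρ := by
  classical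
  induction t with
  | zero =>
    refine ⟨π.Ω, π.mΩ, π.μ, π.prob, id, fun j => j.elim0, measurable_id, fun j => j.elim0,
      fun O _ w _ F hF => ?_⟩
    rw [Algorithm.transcriptLaw, lintegral_map hF (by fun_prop)]
    refine lintegral_congr fun s => ?_
    simp only [Finset.univ_unique, Finset.sum_singleton, Finset.univ_eq_empty, Finset.prod_empty,
      one_mul, id]
    congr 2
    funext j; exact j.elim0
  | succ t ih =>
    obtain ⟨Θ, _, ρ, _, ω, z, hω, hz, h⟩ := ih
    have hz' : ∀ j, Measurable fun θ : Θ × (Fin ℓ → ℝ) =>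
        (Fin.snoc (α := fun _ => Θ × (Fin ℓ → ℝ) → Fin ℓ → ℝ) (fun j θ => z j θ.1)
          (fun θ => θ.2) : Fin (t + 1) → _) j θ := fun j => by
      induction j using Fin.lastCases with
      | last => simpa using measurable_snd
      | cast j => simpa [Function.comp_def] using (hz j).comp measurable_fst
    -- The fresh noise of the new round joins the auxiliary space. That space is fixed before the
    -- oracle, so all parameters `v` share it.
    refine ⟨Θ × (Fin ℓ → ℝ), Prod.instMeasurableSpace, ρ.prod (channelNoise ℓ σ2), inferInstance,
      fun θ => ω θ.1, Fin.snoc (α := fun _ => Θ × (Fin ℓ → ℝ) → Fin ℓ → ℝ)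
        (fun j θ => z j θ.1) (fun θ => θ.2), by fun_prop, hz', fun O _ w hO F hF => ?_⟩
    have hFg : ∀ g : Fin (t + 1) → ι, Measurable fun θ : Θ × (Fin ℓ → ℝ) =>
        F (ω θ.1, fun j => φ.enc (emb (g j)) (π.U j (ω θ.1)) +
          (Fin.snoc (α := fun _ => Θ × (Fin ℓ → ℝ) → Fin ℓ → ℝ) (fun j θ => z j θ.1)
            (fun θ => θ.2) : Fin (t + 1) → _) j θ) := fun g =>
      hF.comp ((hω.comp measurable_fst).prodMk (measurable_pi_iff.2 fun j =>
        measurable_enc_add π j measurable_const (hω.comp measurable_fst) (hz' j)))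
    have hG : Measurable fun s : π.Ω × (Fin t → Fin ℓ → ℝ) => ∑ a, w a * ∫⁻ z, F (s.1,
        Fin.snoc (α := fun _ => Fin ℓ → ℝ) s.2 (φ.enc (emb a) (π.U t s.1) + z))
          ∂(channelNoise ℓ σ2) := by
      refine Finset.measurable_sum _ fun a _ => Measurable.const_mul ?_ _
      refine Measurable.lintegral_prod_right' (f := fun s : (π.Ω × (Fin t → Fin ℓ → ℝ)) ×
        (Fin ℓ → ℝ) => F (s.1.1, Fin.snoc (α := fun _ => Fin ℓ → ℝ) s.1.2
          (φ.enc (emb a) (π.U t s.1.1) + s.2))) (hF.comp ?_)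
      exact (by fun_prop : Measurable _).prodMk (measurable_snoc (by fun_prop)
        (measurable_enc_add π t (by fun_prop) (by fun_prop) (by fun_prop)))
    rw [lintegral_transcriptLaw_succ π σ2 O w hO t F hF, h O w hO _ hG,
      lintegral_prod _ (Finset.measurable_sum _ fun g _ => (hFg g).const_mul _).aemeasurable]
    refine lintegral_congr fun θ => ?_
    have hFθ : ∀ g : Fin (t + 1) → ι, Measurable fun y : Fin ℓ → ℝ =>
        F (ω θ, fun j => φ.enc (emb (g j)) (π.U j (ω θ)) +
          (Fin.snoc (α := fun _ => Θ × (Fin ℓ → ℝ) → Fin ℓ → ℝ) (fun j θ => z j θ.1)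
            (fun θ => θ.2) : Fin (t + 1) → _) j (θ, y)) := fun g =>
      (hFg g).comp (measurable_prodMk_left (x := θ))
    rw [lintegral_finsetSum _ fun g _ => (hFθ g).const_mul _,
      ← (Fin.snocEquiv fun _ : Fin (t + 1) => ι).sum_comp, Fintype.sum_prod_type,
      Finset.sum_comm]
    refine Finset.sum_congr rfl fun g _ => ?_
    rw [Finset.mul_sum]
    refine Finset.sum_congr rfl fun a _ => ?_
    rw [lintegral_const_mul _ (hFθ _), Fin.prod_univ_castSucc, ← mul_assoc]
    congr 1
    · simp [Fin.snocEquiv]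
    · refine lintegral_congr fun z' => ?_
      congr 2
      funext j
      induction j using Fin.lastCases with
      | last => simp [Fin.snocEquiv]
      | cast j => simp [Fin.snocEquiv]

end Transcript

/-! ### The hard functions and their oracles. -/

section Oracle

open Finset

variable {d : ℕ}

/-- The cube of half side length `r` around the origin. -/
def box (d : ℕ) (r : ℝ) : Set (Vec d) := {x | ∀ i, |x i| ≤ r}

theorem box_nonempty {r : ℝ} (hr : 0 ≤ r) : (box d r).Nonempty := ⟨0, fun i => by simpa using hr⟩

theorem convex_box (r : ℝ) : Convex ℝ (box d r) := by
  intro x hx y hy a b ha hb hab i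
  have hc := convex_Icc (-r) r (abs_le.1 (hx i)) (abs_le.1 (hy i)) ha hb hab
  exact abs_le.2 hc

theorem norm_sub_le_of_mem_box {r : ℝ} {x y : Vec d} (hr : 0 ≤ r) (hx : x ∈ box d r)
    (hy : y ∈ box d r) : ‖x - y‖ ≤ 2 * r * √d := by
  rw [EuclideanSpace.norm_eq]
  refine Real.sqrt_le_iff.2 ⟨by positivity, ?_⟩
  calc ∑ i, ‖(x - y) i‖ ^ 2 ≤ ∑ _i : Fin d, (2 * r) ^ 2 := by
        refine sum_le_sum fun i _ => ?_
        have h : ‖(x - y) i‖ ≤ 2 * r := by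
          have h1 := abs_le.1 (hx i)
          have h2 := abs_le.1 (hy i)
          rw [PiLp.sub_apply, Real.norm_eq_abs, abs_le]
          constructor <;> linarith
        gcongr
    _ = _ := by simp [mul_pow]; ring

/-- The vector in `ℝ^d` with coordinates `± b` that the oracles below use as an answer. -/
noncomputable def answer (b : ℝ) (x : Fin d → Bool) : Vec d :=
  WithLp.toLp 2 fun i => -b * bitSign (x i)

theorem norm_sq_answer (b : ℝ) (x : Fin d → Bool) : ‖answer b x‖ ^ 2 = d * b ^ 2 := by
  rw [EuclideanSpace.norm_sq_eq]
  have : ∀ i, ‖answer b x i‖ ^ 2 = b ^ 2 := fun i => by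
    rw [Real.norm_eq_abs, sq_abs]
    simp only [answer]
    linear_combination b ^ 2 * bitSign_sq (x i)
  simp only [this, sum_const, card_univ, Fintype.card_fin, nsmul_eq_mul]

/-- The law of the answers of the oracle with parameter `v` and bias `δ`. -/
noncomputable def answerLaw (b δ : ℝ) (v : Fin d → Bool) : Measure (Vec d) :=
  ∑ x, ENNReal.ofReal (cubeProb δ v x) • Measure.dirac (answer b x)

theorem lintegral_answerLaw (b δ : ℝ) (v : Fin d → Bool) {F : Vec d → ℝ≥0∞} (hF : Measurable F) :
    ∫⁻ g, F g ∂(answerLaw b δ v) = ∑ x, ENNReal.ofReal (cubeProb δ v x) * F (answer b x) := by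
  simp [answerLaw, lintegral_finsetSum_measure, lintegral_dirac' _ hF]

theorem sum_ofReal_cubeProb {δ : ℝ} (h0 : 0 ≤ δ) (h1 : δ < 1) (v : Fin d → Bool) :
    ∑ x, ENNReal.ofReal (cubeProb δ v x) = 1 := by
  rw [← ENNReal.ofReal_sum_of_nonneg fun x _ => (cubeProb_pos h0 h1 v x).le, sum_cubeProb,
    ENNReal.ofReal_one]

theorem isProbabilityMeasure_answerLaw {δ : ℝ} (h0 : 0 ≤ δ) (h1 : δ < 1) (b : ℝ)
    (v : Fin d → Bool) : IsProbabilityMeasure (answerLaw b δ v) := by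
  refine ⟨?_⟩
  rw [← lintegral_one, lintegral_answerLaw b δ v measurable_const]
  simpa using sum_ofReal_cubeProb h0 h1 v

theorem integral_answerLaw {δ : ℝ} (h0 : 0 ≤ δ) (h1 : δ < 1) (b : ℝ) (v : Fin d → Bool) :
    ∫ g, g ∂(answerLaw b δ v) = answer (b * δ) v := by
  have hint : ∀ x ∈ univ, Integrable (fun g : Vec d => g)
      (ENNReal.ofReal (cubeProb δ v x) • Measure.dirac (answer b x)) := fun x _ =>
    (integrable_dirac (by simp)).smul_measure ENNReal.ofReal_ne_top
  rw [answerLaw, integral_finsetSum_measure hint]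
  ext i
  simp only [integral_smul_measure, integral_dirac,
    ENNReal.toReal_ofReal (cubeProb_pos h0 h1 v _).le, WithLp.ofLp_sum, Finset.sum_apply,
    PiLp.smul_apply, smul_eq_mul, answer]
  have : ∀ x, cubeProb δ v x * (-b * bitSign (x i)) = -b * (cubeProb δ v x * bitSign (x i)) :=
    fun x => by ring
  simp only [this, ← mul_sum, sum_cubeProb_mul_bitSign]
  ring

/-- On `box d r` this is the function `x ↦ a * ‖x - r v‖₁`, where `v` is read as a vector of
signs. -/
noncomputable def hardFunction (a r : ℝ) (v : Fin d → Bool) (x : Vec d) : ℝ :=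
  ∑ i, a * (r - bitSign (v i) * x i)

theorem hardFunction_eq_add_inner (a r : ℝ) (v : Fin d → Bool) (x y : Vec d) :
    hardFunction a r v y = hardFunction a r v x + inner ℝ (answer a v) (y - x) := by
  simp only [hardFunction, PiLp.inner_apply, answer, ← sum_add_distrib]
  refine sum_congr rfl fun i _ => ?_
  simp
  ring

theorem convexOn_hardFunction (a r : ℝ) (v : Fin d → Bool) {X : Set (Vec d)} (hX : Convex ℝ X) :
    ConvexOn ℝ X (hardFunction a r v) := by
  refine ⟨hX, fun x _ y _ s t _ _ hst => le_of_eq ?_⟩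
  rw [hardFunction_eq_add_inner a r v 0 (s • x + t • y), hardFunction_eq_add_inner a r v 0 x,
    hardFunction_eq_add_inner a r v 0 y]
  simp only [sub_zero, inner_add_right, inner_smul_right, smul_eq_mul]
  linear_combination (-hardFunction a r v 0) * hst

theorem measurable_hardFunction (a r : ℝ) (v : Fin d → Bool) :
    Measurable (hardFunction a r v) := by
  unfold hardFunction
  fun_prop

/-- A coordinate of the wrong sign costs at least `a * r` and every other one is nonnegative on the
box. This turns optimization error into a Hamming distance. -/
theorem le_hardFunction {a r : ℝ} (ha : 0 ≤ a) (v : Fin d → Bool) {x : Vec d}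
    (hx : x ∈ box d r) :
    a * r * ∑ i, (if decide (0 ≤ x i) ≠ v i then 1 else 0) ≤ hardFunction a r v x := by
  rw [hardFunction, mul_sum]
  refine sum_le_sum fun i _ => ?_
  rw [mul_assoc]
  refine mul_le_mul_of_nonneg_left ?_ ha
  have h := abs_le.1 (hx i)
  by_cases h0 : 0 ≤ x i <;> cases v i <;> simp [h0, bitSign] <;> linarith

theorem sInf_hardFunction_le {a r : ℝ} (ha : 0 ≤ a) (hr : 0 ≤ r) (v : Fin d → Bool) :
    sInf (hardFunction a r v '' box d r) ≤ 0 := by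
  refine csInf_le ⟨0, ?_⟩ ⟨WithLp.toLp 2 fun i => r * bitSign (v i), fun i => ?_, ?_⟩
  · rintro _ ⟨x, hx, rfl⟩
    refine le_trans ?_ (le_hardFunction ha v hx)
    have : (0 : ℝ) ≤ ∑ i, (if decide (0 ≤ x i) ≠ v i then 1 else 0) :=
      sum_nonneg fun i _ => by split_ifs <;> norm_num
    positivity
  · cases h : v i <;> simp [h, bitSign, abs_of_nonneg hr]
  · refine sum_eq_zero fun i _ => ?_
    simp only
    linear_combination (-a * r) * bitSign_sq (v i)

/-- The function `hardFunction` with an oracle that gives the same answers at all points. -/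
noncomputable def hardPair {δ B : ℝ} (h0 : 0 ≤ δ) (h1 : δ < 1) (hd : 0 < d) (r : ℝ)
    (v : Fin d → Bool) : OraclePair (box d r) B where
  f := hardFunction (B / √d * δ) r v
  oracle := Kernel.const _ (answerLaw (B / √d) δ v)
  markov := by
    have := isProbabilityMeasure_answerLaw h0 h1 (B / √d) v
    infer_instance
  convex := convexOn_hardFunction _ _ _ (convex_box r)
  unbiased x _ y _ := by
    rw [Kernel.const_apply, integral_answerLaw h0 h1]
    exact (hardFunction_eq_add_inner _ _ _ _ _).ge
  meanSquare x _ := by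
    rw [Kernel.const_apply, lintegral_answerLaw _ _ _ (by fun_prop)]
    have hd' : (0 : ℝ) < d := by exact_mod_cast hd
    have : ∀ y : Fin d → Bool, ‖answer (B / √d) y‖ₑ ^ 2 = ENNReal.ofReal (B ^ 2) := fun y => by
      rw [← ofReal_norm, ← ENNReal.ofReal_pow (norm_nonneg _), norm_sq_answer, div_pow,
        Real.sq_sqrt hd'.le, mul_div_cancel₀ _ hd'.ne']
    simp only [this, ← sum_mul, sum_ofReal_cubeProb h0 h1, one_mul, le_refl]

end Oracle

/-! ### Counting the messages of a coordinate sampling code. -/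

section Messages

open Finset

/-- A set of `k` coordinates with a bit for each of them. -/
abbrev SampledBits (d k : ℕ) : Type := Σ s : {s : Finset (Fin d) // s.card = k}, (s.1 → Bool)

theorem card_sampledBits (d k : ℕ) : Fintype.card (SampledBits d k) = d.choose k * 2 ^ k := by
  have : ∀ s : {s : Finset (Fin d) // s.card = k}, Fintype.card (s.1 → Bool) = 2 ^ k := fun s => by
    simp [s.2]
  rw [Fintype.card_sigma]
  simp only [this, sum_const, card_univ, Fintype.card_finset_len, Fintype.card_fin, smul_eq_mul]

/-- From `choose d k ≤ (e d / k) ^ k`. The factor 2 absorbs the `k log 2` of the bits, and passing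
to base 2 only increases the logarithm. -/
theorem log_card_sampledBits_le {d k : ℕ} (hk : 1 ≤ k) (hkd : k ≤ d) :
    Real.log (Fintype.card (SampledBits d k)) ≤
      2 * (k * (1 + Real.logb 2 ((d : ℝ) / k))) := by
  have hk0 : (0 : ℝ) < k := by exact_mod_cast hk
  have hkd' : (k : ℝ) ≤ d := by exact_mod_cast hkd
  have hd0 : (0 : ℝ) < d := by linarith
  have hchoose : (d.choose k : ℝ) ≤ ((d : ℝ) / k) ^ k * Real.exp k := by
    have hexp := Real.pow_div_factorial_le_exp (x := (k : ℝ)) hk0.le k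
    calc (d.choose k : ℝ) ≤ (d : ℝ) ^ k / k.factorial := Nat.choose_le_pow_div k d
      _ = ((d : ℝ) / k) ^ k * ((k : ℝ) ^ k / k.factorial) := by
        rw [div_pow]; field_simp
      _ ≤ _ := by gcongr
  have hpos : (0 : ℝ) < d.choose k := by exact_mod_cast Nat.choose_pos hkd
  have hlog : Real.log (d.choose k) ≤ k * Real.log ((d : ℝ) / k) + k := by
    have := Real.log_le_log hpos hchoose
    rwa [Real.log_mul (by positivity) (Real.exp_pos _).ne', Real.log_pow, Real.log_exp] at this
  have hnn : 0 ≤ Real.log ((d : ℝ) / k) := Real.log_nonneg ((one_le_div hk0).2 hkd')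
  have h2 := Real.log_two_lt_d9
  have hlogb : Real.log ((d : ℝ) / k) ≤ Real.logb 2 ((d : ℝ) / k) := by
    rw [Real.logb, le_div_iff₀ (Real.log_pos one_lt_two)]
    nlinarith
  rw [card_sampledBits]
  push_cast
  rw [Real.log_mul hpos.ne' (by positivity), Real.log_pow]
  nlinarith

end Messages

/-! ### From bit errors to the min-max error. -/

section LowerBound

variable {d ℓ T k : ℕ}

/-- With the auxiliary randomness `θ` fixed, the signs of the output estimate `v` from `T` messages,
so Assouad's bound applies for each `θ`. Integrating and averaging over the `2 ^ d` parameters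
bounds the supremum. -/
theorem le_iSup_error {r B δ : ℝ} (hr : 0 ≤ r) (hB : 0 ≤ B) (h0 : 0 ≤ δ) (h1 : δ ≤ 1 / 2)
    (hd : 0 < d) (hT : T * (16 * δ ^ 2 *
      min (d : ℝ) (Real.log (Fintype.card (SampledBits d k)))) ≤ d / 4)
    {φ : Code d ℓ} (hφ : φ.IsCoordinateSampling k) (π : Algorithm (box d r) T φ) (σ2 : ℝ≥0) :
    ENNReal.ofReal (B / √d * δ * r * (d / 8)) ≤ ⨆ p : OraclePair (box d r) B, π.error σ2 p := by
  have h1' : δ < 1 := by linarith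
  have ha : 0 ≤ B / √d * δ := by positivity
  obtain ⟨S, e, hS, he⟩ := hφ
  set b := B / √d with hb
  -- The selected set may depend on the whole answer, which is why it is part of the message.
  let m : φ.𝒰 → (Fin d → Bool) → SampledBits d k := fun u x =>
    ⟨⟨S (answer b x) u, hS _ _⟩, fun i => x i⟩
  let dec : φ.𝒰 → SampledBits d k → Fin ℓ → ℝ := fun u y =>
    e u y.1.1 fun i => -b * bitSign (y.2 i)
  have hdec : ∀ u x, φ.enc (answer b x) u = dec u (m u x) := fun u x => he _ _
  obtain ⟨Θ, _, ρ, _, ω, z, hω, hz, hlaw⟩ :=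
    exists_lintegral_transcriptLaw_eq π σ2 (answer b) T
  let p : (Fin d → Bool) → OraclePair (box d r) B := hardPair h0 h1' hd r
  have herror : ∀ v, ∫⁻ θ, ∑ g : Fin T → Fin d → Bool, ENNReal.ofReal
      ((∏ t, cubeProb δ v (g t)) * hardFunction (b * δ) r v (π.output (ω θ, fun t =>
        dec (π.U t (ω θ)) (m (π.U t (ω θ)) (g t)) + z t θ))) ∂ρ ≤ π.error σ2 (p v) := fun v => by
    have hmeas : Measurable fun s => ENNReal.ofReal ((p v).f (π.output s)
        - sInf ((p v).f '' box d r)) :=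
      (((measurable_hardFunction _ _ _).comp π.measurable_output).sub_const _).ennreal_ofReal
    rw [Algorithm.error, hlaw (p v).oracle (fun x => ENNReal.ofReal (cubeProb δ v x))
      (fun x F hF => lintegral_answerLaw _ _ _ hF) _ hmeas]
    refine lintegral_mono fun θ => Finset.sum_le_sum fun g _ => ?_
    rw [← ENNReal.ofReal_prod_of_nonneg fun t _ => (cubeProb_pos h0 h1' v _).le,
      ENNReal.ofReal_mul (Finset.prod_nonneg fun t _ => (cubeProb_pos h0 h1' v _).le)]
    simp only [hdec]
    refine mul_le_mul_right (ENNReal.ofReal_le_ofReal ?_) _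
    have := sInf_hardFunction_le (d := d) ha hr v
    change _ ≤ hardFunction (b * δ) r v _ - sInf (hardFunction (b * δ) r v '' box d r)
    linarith
  have hθ : ∀ θ, ENNReal.ofReal (2 ^ d * (b * δ * r * (d / 8))) ≤
      ∑ v : Fin d → Bool, ∑ g : Fin T → Fin d → Bool, ENNReal.ofReal
      ((∏ t, cubeProb δ v (g t)) * hardFunction (b * δ) r v (π.output (ω θ, fun t =>
        dec (π.U t (ω θ)) (m (π.U t (ω θ)) (g t)) + z t θ))) := fun θ => by
    have hass := le_sum_bit_errors h0 h1 hT (fun t => m (π.U t (ω θ))) fun y i =>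
      decide (0 ≤ π.output (ω θ, fun t => dec (π.U t (ω θ)) (y t) + z t θ) i)
    have hterm : ∀ (v : Fin d → Bool) (g : Fin T → Fin d → Bool), b * δ * r * ((∏ t, cubeProb δ v (g t)) *
        ∑ i, (if decide (0 ≤ π.output (ω θ, fun t => dec (π.U t (ω θ))
          (m (π.U t (ω θ)) (g t)) + z t θ) i) ≠ v i then 1 else 0)) ≤
        (∏ t, cubeProb δ v (g t)) * hardFunction (b * δ) r v (π.output (ω θ, fun t =>
          dec (π.U t (ω θ)) (m (π.U t (ω θ)) (g t)) + z t θ)) := fun v g => by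
      rw [mul_left_comm]
      exact mul_le_mul_of_nonneg_left (le_hardFunction ha v (π.output_mem _))
        (Finset.prod_nonneg fun t _ => (cubeProb_pos h0 h1' v _).le)
    have hsum := Finset.sum_le_sum fun v (_ : v ∈ Finset.univ) =>
      Finset.sum_le_sum fun g (_ : g ∈ Finset.univ) => hterm v g
    simp only [← Finset.mul_sum] at hsum
    refine (ENNReal.ofReal_le_ofReal (le_trans ?_ hsum)).trans
      ((Finset.le_sum_of_subadditive _ ENNReal.ofReal_zero.le (fun _ _ => ENNReal.ofReal_add_le)
        _ _).trans (Finset.sum_le_sum fun v _ => Finset.le_sum_of_subadditive _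
          ENNReal.ofReal_zero.le (fun _ _ => ENNReal.ofReal_add_le) _ _))
    calc _ = b * δ * r * (2 ^ d * ((d : ℝ) / 8)) := by ring
      _ ≤ _ := mul_le_mul_of_nonneg_left hass (by positivity)
  have htotal : 2 ^ d * ENNReal.ofReal (b * δ * r * (d / 8)) ≤
      2 ^ d * ⨆ p : OraclePair (box d r) B, π.error σ2 p := by
    calc (2 : ℝ≥0∞) ^ d * ENNReal.ofReal (b * δ * r * (d / 8))
        = ENNReal.ofReal (2 ^ d * (b * δ * r * (d / 8))) := by
          rw [ENNReal.ofReal_mul (p := 2 ^ d) (by positivity), ENNReal.ofReal_pow (by norm_num)]; simp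
      _ = ∫⁻ _, ENNReal.ofReal (2 ^ d * (b * δ * r * (d / 8))) ∂ρ := by simp
      _ ≤ _ := lintegral_mono hθ
      _ ≤ ∑ v, π.error σ2 (p v) := by
        rw [lintegral_finsetSum]
        · exact Finset.sum_le_sum fun v _ => herror v
        · intro v _
          refine Finset.measurable_sum _ fun g _ => Measurable.ennreal_ofReal
            (Measurable.const_mul ((measurable_hardFunction _ _ _).comp
              (π.measurable_output.comp (hω.prodMk (measurable_pi_iff.2 fun t => ?_)))) _)
          simp only [← hdec]
          exact measurable_enc_add π t measurable_const hω (hz t)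
      _ ≤ ∑ _v : Fin d → Bool, ⨆ p : OraclePair (box d r) B, π.error σ2 p :=
        Finset.sum_le_sum fun v _ => le_iSup (fun p => π.error σ2 p) (p v)
      _ = _ := by simp
  exact (ENNReal.mul_le_mul_iff_right (by simp) (by simp)).1 htotal

theorem le_kcsError {N : ℕ} {D B P : ℝ} (σ2 : ℝ≥0) (hD : 0 < D) (hB : 0 < B) (hk : 1 ≤ k)
    (hkd : k ≤ d) (hN : (d : ℝ) / min (d : ℝ) (k * (1 + Real.logb 2 ((d : ℝ) / k))) ≤ N) :
    ENNReal.ofReal (1 / 192 * D * B / √(N : ℝ) *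
      √((d : ℝ) / min (d : ℝ) (k * (1 + Real.logb 2 ((d : ℝ) / k))))) ≤
      kcsError k d N D B P σ2 := by
  have hk0 : (0 : ℝ) < k := by exact_mod_cast hk
  have hkd' : (k : ℝ) ≤ d := by exact_mod_cast hkd
  have hd0 : (0 : ℝ) < d := by linarith
  have hlogb : 0 ≤ Real.logb 2 ((d : ℝ) / k) :=
    Real.logb_nonneg one_lt_two ((one_le_div hk0).2 hkd')
  set I := min (d : ℝ) (k * (1 + Real.logb 2 ((d : ℝ) / k))) with hI
  have hI0 : 0 < I := lt_min hd0 (by positivity)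
  have hN0 : (0 : ℝ) < N := (div_pos hd0 hI0).trans_le hN
  have hsd : 0 < √(d : ℝ) := Real.sqrt_pos.2 hd0
  set r := D / (2 * √(d : ℝ)) with hr
  have hr0 : 0 ≤ r := by positivity
  -- With `1/12`, the information budget is at most `32 d / 144 ≤ d / 4`, and the final constant is
  -- `1 / (12 · 2 · 8) = 1/192`.
  set δ := 1 / 12 * (√((d : ℝ) / I) / √(N : ℝ)) with hδ
  have hδ0 : 0 ≤ δ := by positivity
  have hδ1 : δ ≤ 1 / 2 := by
    have : √((d : ℝ) / I) / √(N : ℝ) ≤ 1 :=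
      div_le_one_of_le₀ (Real.sqrt_le_sqrt hN) (Real.sqrt_nonneg _)
    linarith
  have hδsq : δ ^ 2 * (N * I) = d / 144 := by
    rw [hδ, mul_pow, div_pow (√_), Real.sq_sqrt (by positivity), Real.sq_sqrt hN0.le]
    field_simp
    norm_num
  have hinfo : min (d : ℝ) (Real.log (Fintype.card (SampledBits d k))) ≤ 2 * I := by
    rw [hI, mul_min_of_nonneg _ _ zero_le_two]
    exact min_le_min (by linarith) (log_card_sampledBits_le hk hkd)
  refine le_iSup_of_le (box d r) (le_iSup_of_le (box_nonempty hr0) (le_iSup_of_le (convex_box r)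
    (le_iSup_of_le (fun x hx y hy => (norm_sub_le_of_mem_box hr0 hx hy).trans (le_of_eq ?_)) ?_)))
  · rw [hr]; field_simp
  refine le_iInf fun ℓ => le_iInf fun T => le_iInf fun hℓ => le_iInf fun hT => le_iInf fun φ =>
    le_iInf fun hφ => le_iInf fun π => le_iInf fun _ => ?_
  have hTN : (T : ℝ) ≤ N := by
    exact_mod_cast (Nat.le_mul_of_pos_left T hℓ).trans hT
  refine le_trans (le_of_eq ?_) (le_iSup_error hr0 hB.le hδ0 hδ1 (by omega) ?_ hφ π σ2)
  · congr 1
    rw [hr, hδ]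
    have : √(d : ℝ) * √(d : ℝ) = d := Real.mul_self_sqrt hd0.le
    have hsN : 0 < √(N : ℝ) := Real.sqrt_pos.2 hN0
    rw [show B / √(d : ℝ) * (1 / 12 * (√((d : ℝ) / I) / √(N : ℝ))) * (D / (2 * √(d : ℝ))) *
      ((d : ℝ) / 8) = B * D * √((d : ℝ) / I) / √(N : ℝ) / 192 * (d / (√(d : ℝ) * √(d : ℝ))) by
        field_simp; norm_num, this, div_self hd0.ne']
    ring
  · calc T * (16 * δ ^ 2 * min (d : ℝ) (Real.log (Fintype.card (SampledBits d k))))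
        ≤ N * (16 * δ ^ 2 * (2 * I)) := by gcongr
      _ = 32 * (δ ^ 2 * (N * I)) := by ring
      _ ≤ _ := by rw [hδsq]; linarith

/-- For `2k ≤ d` the logarithm is at least 1, so both minima agree up to a factor 4. The square root
costs a factor 2 in the constant. -/
theorem le_kcsError_of_two_mul_le {N : ℕ} {D B P : ℝ} (σ2 : ℝ≥0) (hD : 0 < D) (hB : 0 < B)
    (hk : 1 ≤ k) (hkd : 2 * k ≤ d)
    (hN : (d : ℝ) / min (d : ℝ) (k * Real.logb 2 ((d : ℝ) / k)) ≤ N) :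
    ENNReal.ofReal (1 / 384 * D * B / √(N : ℝ) *
      √((d : ℝ) / min (d : ℝ) (k * Real.logb 2 ((d : ℝ) / k)))) ≤
      kcsError k d N D B P σ2 := by
  have hk0 : (0 : ℝ) < k := by exact_mod_cast hk
  have hkd' : 2 * (k : ℝ) ≤ d := by exact_mod_cast hkd
  have hd0 : (0 : ℝ) < d := by linarith
  have hlogb : 1 ≤ Real.logb 2 ((d : ℝ) / k) := by
    rw [Real.le_logb_iff_rpow_le one_lt_two (by positivity), Real.rpow_one, le_div_iff₀ hk0]
    exact hkd'
  set L := Real.logb 2 ((d : ℝ) / k) with hL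
  have hm0 : 0 < min (d : ℝ) (k * L) := lt_min hd0 (by positivity)
  have hle : min (d : ℝ) (k * L) ≤ min (d : ℝ) (k * (1 + L)) :=
    min_le_min le_rfl (by nlinarith)
  have hle2 : min (d : ℝ) (k * (1 + L)) ≤ 4 * min (d : ℝ) (k * L) := by
    rw [mul_min_of_nonneg _ _ (by norm_num)]
    exact min_le_min (by linarith) (by nlinarith)
  refine le_trans (ENNReal.ofReal_le_ofReal ?_)
    (le_kcsError σ2 hD hB hk (by omega)
      ((div_le_div_of_nonneg_left hd0.le hm0 hle).trans hN))
  have hsqrt : √((d : ℝ) / min (d : ℝ) (k * L)) ≤ 2 * √((d : ℝ) / min (d : ℝ) (k * (1 + L))) := by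
    refine Real.sqrt_le_iff.2 ⟨by positivity, ?_⟩
    have hm1 := hm0.trans_le hle
    rw [mul_pow, Real.sq_sqrt (by positivity), ← mul_div_assoc, div_le_div_iff₀ hm0 hm1]
    nlinarith
  calc _ ≤ 1 / 384 * D * B / √(N : ℝ) * (2 * √((d : ℝ) / min (d : ℝ) (k * (1 + L)))) := by
        gcongr
    _ = _ := by ring

/-- For a small fraction `k / d`, the factor `d / min {d, k log (d / k)}` is large. -/
theorem le_div_min_mul_logb {K : ℝ} (hK : 1 ≤ K) (hk : 1 ≤ k)
    (hkd : (k : ℝ) ≤ 1 / (16 * K ^ 2) * d) (hd : 2 * k ≤ d) :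
    √K ≤ √((d : ℝ) / min (d : ℝ) (k * Real.logb 2 ((d : ℝ) / k))) := by
  have hk0 : (0 : ℝ) < k := by exact_mod_cast hk
  have hd2 : 2 * (k : ℝ) ≤ d := by exact_mod_cast hd
  have hd0 : (0 : ℝ) < d := by linarith
  set x := (d : ℝ) / k with hx
  have hx0 : 0 < x := by positivity
  have hx2 : 2 ≤ x := by rw [hx, le_div_iff₀ hk0]; exact hd2
  have hxK : (4 * K) ^ 2 ≤ x := by
    rw [hx, le_div_iff₀ hk0]
    rw [one_div, inv_mul_eq_div, le_div_iff₀ (by positivity)] at hkd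
    linarith
  have hsx : 4 * K ≤ √x := Real.le_sqrt_of_sq_le hxK
  -- Uses `log √x ≤ √x` and `log 2 ≥ 1/2`.
  have hlog : Real.logb 2 x ≤ 4 * √x := by
    have h1 : Real.log x ≤ 2 * √x := by
      have := Real.log_le_self (Real.sqrt_nonneg x)
      rw [Real.log_sqrt hx0.le] at this
      linarith
    rw [Real.logb, div_le_iff₀ (Real.log_pos one_lt_two)]
    nlinarith [Real.log_two_gt_d9, Real.sqrt_nonneg x]
  have hlog0 : 0 < Real.logb 2 x := Real.logb_pos one_lt_two (by linarith)
  refine Real.sqrt_le_sqrt ?_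
  rw [le_div_iff₀ (lt_min hd0 (by positivity))]
  calc K * min (d : ℝ) (k * Real.logb 2 x) ≤ K * (k * Real.logb 2 x) := by
        gcongr; exact min_le_right _ _
    _ ≤ √x / 4 * (k * (4 * √x)) := by gcongr; linarith
    _ = k * (√x * √x) := by ring
    _ = d := by rw [Real.mul_self_sqrt hx0.le, hx, mul_div_cancel₀ _ hk0.ne']

end LowerBound

end OverTheAir

theorem mainTheorem7 :
    (∃ c : ℝ, 0 < c ∧
      ∀ (d k N : ℕ) (D B P : ℝ) (σ2 : ℝ≥0), 0 < D → 0 < B → 0 < P → 1 ≤ k →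
        (2 * k ≤ d →
          (d : ℝ) / min (d : ℝ) (k * Real.logb 2 ((d : ℝ) / k)) ≤ N →
          ENNReal.ofReal (c * D * B / √(N : ℝ) *
              √((d : ℝ) / min (d : ℝ) (k * Real.logb 2 ((d : ℝ) / k))))
            ≤ OverTheAir.kcsError k d N D B P σ2) ∧
        (k ≤ d →
          (d : ℝ) / min (d : ℝ) (k * (1 + Real.logb 2 ((d : ℝ) / k))) ≤ N →
          ENNReal.ofReal (c * D * B / √(N : ℝ) *
              √((d : ℝ) / min (d : ℝ) (k * (1 + Real.logb 2 ((d : ℝ) / k)))))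
            ≤ OverTheAir.kcsError k d N D B P σ2)) ∧
    (∀ C : ℝ, 0 < C → ∃ ε : ℝ, 0 < ε ∧ ε ≤ 1 / 2 ∧
      ∀ (d k N : ℕ) (D B P : ℝ), 0 < D → 0 < B → 0 < P → 1 ≤ k → (k : ℝ) ≤ ε * d →
        (d : ℝ) / min (d : ℝ) (k * Real.logb 2 ((d : ℝ) / k)) ≤ N →
          ENNReal.ofReal (C * D * B / √(N : ℝ)) ≤ OverTheAir.kcsError k d N D B P 0) := by
  refine ⟨⟨1 / 384, by norm_num, fun d k N D B P σ2 hD hB _ hk => ⟨fun hkd hN =>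
    OverTheAir.le_kcsError_of_two_mul_le σ2 hD hB hk hkd hN, fun hkd hN =>
    le_trans (ENNReal.ofReal_le_ofReal ?_) (OverTheAir.le_kcsError σ2 hD hB hk hkd hN)⟩⟩,
    fun C hC => ?_⟩
  · gcongr
    norm_num
  -- `√K ≥ 384 C` cancels the constant `1/384`; the summand 1 gives `K ≥ 1`, hence `ε ≤ 1/2`.
  · set K := 1 + (384 * C) ^ 2 with hK
    have hK1 : 1 ≤ K := by rw [hK]; linarith [sq_nonneg (384 * C)]
    refine ⟨1 / (16 * K ^ 2), by positivity, ?_, fun d k N D B P hD hB _ hk hkd hN => ?_⟩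
    · exact one_div_le_one_div_of_le two_pos (by nlinarith)
    have hd : 2 * k ≤ d := by
      have h : (1 : ℝ) / (16 * K ^ 2) ≤ 1 / 2 :=
        one_div_le_one_div_of_le two_pos (by nlinarith)
      have : 2 * (k : ℝ) ≤ d := by nlinarith [(Nat.cast_nonneg d : (0 : ℝ) ≤ d)]
      exact_mod_cast this
    refine le_trans (ENNReal.ofReal_le_ofReal ?_)
      (OverTheAir.le_kcsError_of_two_mul_le 0 hD hB hk hd hN)
    have hCK : 384 * C ≤ √K := Real.le_sqrt_of_sq_le (by rw [hK]; linarith)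
    calc C * D * B / √(N : ℝ) = 1 / 384 * D * B / √(N : ℝ) * (384 * C) := by ring
      _ ≤ _ := by
        gcongr
        exact hCK.trans (OverTheAir.le_div_min_mul_logb hK1 hk hkd hd)
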